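/- For $0<d\le\pi$, call a real number $\mu$ an eigenvalue of the Neumann Sturm--Liouville problem $$(y'\cos x)'+\mu\,y\cos x=0\quad\text{on }[-d/2,d/2],\qquad y'(\pm d/2)=0,$$ if it has a solution $y:[-d/2,d/2]\to\mathbb R$ that is not identically zero, where $y$ and $y'\cos x$ are differentiable on the closed interval (with one-sided derivatives at the endpoints). Then for every $0<d\le\pi$ the set of nonzero eigenvalues has a least element $\mu(d)$, and $$2+2\bigl(1-\sin(d/2)\bigr)\le\mu(d).$$ -/

import Mathlib

/-- `μ` is a (real) eigenvalue of the Sturm-Liouville problem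
`(y' cos x)' + μ y cos x = 0` on `[-d/2, d/2]`, with Neumann conditions `y'(±d/2) = 0`:
there is an eigenfunction `y`, not identically zero on the interval, with derivative `y'`.
Derivatives at the two endpoints are one-sided. -/
def IsNeumannEigenvalue (d μ : ℝ) : Prop :=
  ∃ y y' : ℝ → ℝ,
    (∃ x ∈ Set.Icc (-(d / 2)) (d / 2), y x ≠ 0) ∧
    (∀ x ∈ Set.Icc (-(d / 2)) (d / 2),
      HasDerivWithinAt y (y' x) (Set.Icc (-(d / 2)) (d / 2)) x) ∧
    (∀ x ∈ Set.Icc (-(d / 2)) (d / 2),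
      HasDerivWithinAt (fun t => y' t * Real.cos t) (-(μ * y x * Real.cos x))
        (Set.Icc (-(d / 2)) (d / 2)) x) ∧
    y' (-(d / 2)) = 0 ∧ y' (d / 2) = 0

/-- The set of nonzero eigenvalues of the problem on `[-d/2, d/2]`. -/
def nonzeroNeumannEigenvalues (d : ℝ) : Set ℝ :=
  {μ : ℝ | μ ≠ 0 ∧ IsNeumannEigenvalue d μ}

/-- The first nonzero eigenvalue `μ(d)`. -/
noncomputable def firstNeumannEigenvalue (d : ℝ) : ℝ :=
  sInf (nonzeroNeumannEigenvalues d)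

/-! Put `s = sin x`, `S = sin (d/2)` and `Z(s) = y' cos x`. Then `dZ/ds = -μ y`, and the Neumann
problem becomes the Dirichlet problem `(1 - s²) Z'' + μ Z = 0`, `Z(±S) = 0`. Picone's identity
(`le_of_isNeumannEigenvalue_of_supersolution`) bounds nonzero eigenvalues below by `l` whenever a
positive supersolution for `l` exists. The choice `S² - s²` gives `2 / S² ≤ μ`, and `2 / S² ≥ 4 -
2S` on `(0, 1]`.

A least eigenvalue exists: for `S = 1` it is 2, with `y = sin`. For `S < 1`, take the smallest `μ`
whose even power-series solution vanishes somewhere on `[0, S]`. That solution is positive inside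
and vanishes at `S`, so it yields an eigenfunction and also serves as the supersolution with `l =
μ`. -/

open Set Filter Topology

/-! ### Lower bounds by Picone's identity. -/

/-- Picone comparison: a positive supersolution `φ` of `φ'' + l φ / (1 - s²) = 0` on
`(-sin a, sin a)`, decaying at most linearly at the endpoints, bounds the nonzero Neumann
eigenvalues from below by `l`. -/
theorem le_of_isNeumannEigenvalue_of_supersolution {a l μ c K : ℝ} (ha : 0 < a)
    (hapi : a ≤ Real.pi / 2) {φ φ₁ φ₂ : ℝ → ℝ} (hc : 0 < c)
    (hφ : ∀ s ∈ Ioo (-Real.sin a) (Real.sin a), HasDerivAt φ (φ₁ s) s)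
    (hφ₁ : ∀ s ∈ Ioo (-Real.sin a) (Real.sin a), HasDerivAt φ₁ (φ₂ s) s)
    (hlow : ∀ s ∈ Ioo (-Real.sin a) (Real.sin a), c * (Real.sin a - |s|) ≤ φ s)
    (hK : ∀ s ∈ Ioo (-Real.sin a) (Real.sin a), |φ₁ s| ≤ K)
    (hsuper : ∀ s ∈ Ioo (-Real.sin a) (Real.sin a), φ₂ s ≤ -(l * φ s / (1 - s ^ 2)))
    (hμ : μ ≠ 0) (hev : IsNeumannEigenvalue (2 * a) μ) : l ≤ μ := by
  obtain ⟨y, w, ⟨x₀, hx₀, hyx₀⟩, hy, hw, hw0, hw1⟩ := hev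
  rw [show 2 * a / 2 = a by ring] at *
  by_contra! hlt
  set z : ℝ → ℝ := fun t => w t * Real.cos t with hz
  have hcos : ∀ x ∈ Ioo (-a) a, 0 < Real.cos x := fun x hx =>
    Real.cos_pos_of_mem_Ioo ⟨by linarith [hx.1], by linarith [hx.2]⟩
  have hsin : ∀ x ∈ Ioo (-a) a, Real.sin x ∈ Ioo (-Real.sin a) (Real.sin a) := by
    intro x hx
    rw [← Real.sin_neg]
    exact ⟨Real.sin_lt_sin_of_lt_of_le_pi_div_two (by linarith) (by linarith [hx.2]) hx.1,
      Real.sin_lt_sin_of_lt_of_le_pi_div_two (by linarith [hx.1]) hapi hx.2⟩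
  have hyc : ContinuousOn y (Icc (-a) a) := fun x hx => (hy x hx).continuousWithinAt
  have hzc : ContinuousOn z (Icc (-a) a) := fun x hx => (hw x hx).continuousWithinAt
  have hyd : ∀ x ∈ Ioo (-a) a, HasDerivAt y (w x) x := fun x hx =>
    (hy x (Ioo_subset_Icc_self hx)).hasDerivAt (Icc_mem_nhds hx.1 hx.2)
  have hzd : ∀ x ∈ Ioo (-a) a, HasDerivAt z (-(μ * y x * Real.cos x)) x := fun x hx =>
    (hw x (Ioo_subset_Icc_self hx)).hasDerivAt (Icc_mem_nhds hx.1 hx.2)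
  have hza : z a = 0 := by simp [hz, hw1]
  have hzna : z (-a) = 0 := by simp [hz, hw0]
  obtain ⟨B, hB⟩ := isCompact_Icc.exists_bound_of_continuousOn hyc
  have hB0 : 0 ≤ B := (norm_nonneg _).trans (hB x₀ hx₀)
  set D : ℝ := |μ| * B with hD
  have hD0 : 0 ≤ D := by positivity
  have hDy : ∀ x ∈ Icc (-a) a, |μ * y x| ≤ D := fun x hx => by
    rw [abs_mul]; exact mul_le_mul_of_nonneg_left (hB x hx) (abs_nonneg _)
  -- Since `|z'| ≤ D cos`, both `D sin ± z` increase. As `z(±a) = 0`, `z` decays linearly in `sin a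
  -- - |sin x|`, even when `cos a = 0`.
  have hmono : ∀ e : ℝ, |e| = 1 →
      MonotoneOn (fun x => D * Real.sin x + e * z x) (Icc (-a) a) := by
    intro e he
    refine monotoneOn_of_hasDerivWithinAt_nonneg (convex_Icc _ _)
      (f' := fun x => D * Real.cos x + e * -(μ * y x * Real.cos x)) ?_ ?_ ?_
    · exact (by fun_prop : Continuous fun x => D * Real.sin x).continuousOn.add
        (continuousOn_const.mul hzc)
    · intro x hx
      rw [interior_Icc] at hx
      exact (((Real.hasDerivAt_sin x).const_mul D).add
        ((hzd x hx).const_mul e)).hasDerivWithinAt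
    · intro x hx
      rw [interior_Icc] at hx
      have h1 : e * (μ * y x) ≤ D := by
        refine (le_abs_self _).trans ?_
        rw [abs_mul, he, one_mul]
        exact hDy x (Ioo_subset_Icc_self hx)
      have h2 := mul_nonneg (sub_nonneg.2 h1) (hcos x hx).le
      linarith
  have hzbd : ∀ x ∈ Ioo (-a) a, |z x| ≤ D * (Real.sin a - |Real.sin x|) := by
    intro x hx
    have hx' := Ioo_subset_Icc_self hx
    have l1 := hmono 1 (by simp) hx' (right_mem_Icc.2 (by linarith)) hx.2.le
    have l2 := hmono (-1) (by simp) hx' (right_mem_Icc.2 (by linarith)) hx.2.le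
    have l3 := hmono 1 (by simp) (left_mem_Icc.2 (by linarith)) hx' hx.1.le
    have l4 := hmono (-1) (by simp) (left_mem_Icc.2 (by linarith)) hx' hx.1.le
    simp only [hza, hzna, Real.sin_neg] at l1 l2 l3 l4
    rcases abs_cases (Real.sin x) with ⟨h, -⟩ | ⟨h, -⟩ <;> rw [h, abs_le] <;>
      constructor <;> linarith
  have hgap : ∀ x ∈ Ioo (-a) a, 0 < Real.sin a - |Real.sin x| := fun x hx =>
    sub_pos.2 (abs_lt.2 (hsin x hx))
  have hφpos : ∀ x ∈ Ioo (-a) a, 0 < φ (Real.sin x) := fun x hx =>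
    (mul_pos hc (hgap x hx)).trans_le (hlow _ (hsin x hx))
  have hK0 : 0 ≤ K := (abs_nonneg _).trans (hK _ (hsin 0 ⟨by linarith, ha⟩))
  -- In the variable `s` this is `Z Z' - Z² φ'/φ`, with derivative `(Z' - Z φ'/φ)² + Z Z'' - Z²
  -- φ''/φ`.
  set F : ℝ → ℝ := fun x =>
    -μ * y x * z x - z x ^ 2 * (φ₁ (Real.sin x) / φ (Real.sin x)) with hF
  set F' : ℝ → ℝ := fun x =>
    Real.cos x * ((μ * y x + z x * (φ₁ (Real.sin x) / φ (Real.sin x))) ^ 2 +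
      z x ^ 2 * (-φ₂ (Real.sin x) / φ (Real.sin x) - μ / Real.cos x ^ 2)) with hF'
  have hFd : ∀ x ∈ Ioo (-a) a, HasDerivAt F (F' x) x := by
    intro x hx
    have h1 := (hφ _ (hsin x hx)).comp x (Real.hasDerivAt_sin x)
    have h2 := (hφ₁ _ (hsin x hx)).comp x (Real.hasDerivAt_sin x)
    have h3 := (((hyd x hx).const_mul (-μ)).mul (hzd x hx)).sub
      (((hzd x hx).pow 2).mul (h2.div h1 (hφpos x hx).ne'))
    have hp := (hφpos x hx).ne'
    have hcx := (hcos x hx).ne'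
    refine h3.congr_deriv ?_
    simp only [hF', Function.comp_apply, hz, Pi.pow_apply, Pi.div_apply]
    field_simp
    ring
  have hF'ge : ∀ x ∈ Ioo (-a) a,
      Real.cos x * (z x ^ 2 * ((l - μ) / Real.cos x ^ 2)) ≤ F' x := by
    intro x hx
    have hs := hsuper _ (hsin x hx)
    have h1 : l / Real.cos x ^ 2 ≤ -φ₂ (Real.sin x) / φ (Real.sin x) := by
      rw [le_div_iff₀ (hφpos x hx), Real.cos_sq', div_mul_eq_mul_div]
      linarith
    refine mul_le_mul_of_nonneg_left ?_ (hcos x hx).le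
    have h2 : z x ^ 2 * ((l - μ) / Real.cos x ^ 2) ≤
        z x ^ 2 * (-φ₂ (Real.sin x) / φ (Real.sin x) - μ / Real.cos x ^ 2) := by
      refine mul_le_mul_of_nonneg_left ?_ (sq_nonneg _)
      rw [sub_div]; linarith
    linarith [sq_nonneg (μ * y x + z x * (φ₁ (Real.sin x) / φ (Real.sin x)))]
  have hF'nn : ∀ x ∈ Ioo (-a) a, 0 ≤ F' x := fun x hx => by
    refine le_trans ?_ (hF'ge x hx)
    have := hcos x hx
    have : 0 < l - μ := by linarith
    positivity
  have hFmono : MonotoneOn F (Ioo (-a) a) := by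
    refine monotoneOn_of_hasDerivWithinAt_nonneg (convex_Ioo _ _) (f' := F') ?_ ?_ ?_
    · exact fun x hx => (hFd x hx).continuousAt.continuousWithinAt
    · rw [interior_Ioo]; exact fun x hx => (hFd x hx).hasDerivWithinAt
    · rw [interior_Ioo]; exact hF'nn
  set C : ℝ := D * D + D * D * (K / c) with hC
  have hFbd : ∀ x ∈ Ioo (-a) a, |F x| ≤ C * (Real.sin a - |Real.sin x|) := by
    intro x hx
    have hg := hgap x hx
    have hzx := hzbd x hx
    have h1 : |-μ * y x * z x| ≤ D * (D * (Real.sin a - |Real.sin x|)) := by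
      rw [neg_mul, neg_mul, abs_neg, abs_mul]
      exact mul_le_mul (hDy x (Ioo_subset_Icc_self hx)) hzx (abs_nonneg _) hD0
    have h2 : |φ₁ (Real.sin x) / φ (Real.sin x)| ≤ K / (c * (Real.sin a - |Real.sin x|)) := by
      rw [abs_div, abs_of_pos (hφpos x hx)]
      exact div_le_div₀ hK0 (hK _ (hsin x hx)) (mul_pos hc hg) (hlow _ (hsin x hx))
    have h3 : |z x ^ 2 * (φ₁ (Real.sin x) / φ (Real.sin x))| ≤
        (D * (Real.sin a - |Real.sin x|)) ^ 2 * (K / (c * (Real.sin a - |Real.sin x|))) := by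
      rw [abs_mul, abs_pow]
      exact mul_le_mul (pow_le_pow_left₀ (abs_nonneg _) hzx 2) h2 (abs_nonneg _) (sq_nonneg _)
    have h4 : (D * (Real.sin a - |Real.sin x|)) ^ 2 * (K / (c * (Real.sin a - |Real.sin x|))) =
        D * D * (K / c) * (Real.sin a - |Real.sin x|) := by
      field_simp
    calc |F x| ≤ _ := abs_sub _ _
      _ ≤ C * (Real.sin a - |Real.sin x|) := by rw [h4] at h3; rw [hC]; linarith
  have hbound : Continuous fun t => C * (Real.sin a - |Real.sin t|) := by fun_prop
  -- `F` is monotone and tends to 0 at both ends.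
  have hFzero : ∀ x ∈ Ioo (-a) a, F x = 0 := by
    intro x hx
    apply le_antisymm
    · have ht : Tendsto (fun t => C * (Real.sin a - |Real.sin t|)) (𝓝[<] a) (𝓝 0) := by
        have := (hbound.tendsto a).mono_left (nhdsWithin_le_nhds (s := Iio a))
        rwa [abs_of_nonneg (Real.sin_nonneg_of_nonneg_of_le_pi ha.le (by linarith)), sub_self,
          mul_zero] at this
      refine ge_of_tendsto ht ?_
      filter_upwards [Ioo_mem_nhdsLT hx.2] with t ht
      have ht' : t ∈ Ioo (-a) a := ⟨hx.1.trans ht.1, ht.2⟩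
      exact (hFmono hx ht' ht.1.le).trans ((le_abs_self _).trans (hFbd t ht'))
    · have ht : Tendsto (fun t => -(C * (Real.sin a - |Real.sin t|))) (𝓝[>] (-a)) (𝓝 0) := by
        have := ((hbound.tendsto (-a)).mono_left (nhdsWithin_le_nhds (s := Ioi (-a)))).neg
        rwa [Real.sin_neg, abs_neg,
          abs_of_nonneg (Real.sin_nonneg_of_nonneg_of_le_pi ha.le (by linarith)), sub_self,
          mul_zero, neg_zero] at this
      refine le_of_tendsto ht ?_
      filter_upwards [Ioo_mem_nhdsGT hx.1] with t ht
      have ht' : t ∈ Ioo (-a) a := ⟨ht.1, ht.2.trans hx.2⟩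
      exact (neg_le_of_abs_le (hFbd t ht')).trans (hFmono ht' hx ht.2.le)
  have hzzero : ∀ x ∈ Ioo (-a) a, z x = 0 := by
    intro x hx
    have h0 : F' x = 0 := (hFd x hx).unique <| (hasDerivAt_const x (0 : ℝ)).congr_of_eventuallyEq
      (by filter_upwards [Ioo_mem_nhds hx.1 hx.2] with t ht using hFzero t ht)
    have h1 := hF'ge x hx
    rw [h0] at h1
    have hcx := hcos x hx
    have hlm : 0 < l - μ := by linarith
    by_contra hne
    exact absurd h1 (not_le.2 (by positivity))
  have hyzero : ∀ x ∈ Ioo (-a) a, y x = 0 := by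
    intro x hx
    have h0 := (hzd x hx).unique <| (hasDerivAt_const x (0 : ℝ)).congr_of_eventuallyEq
      (by filter_upwards [Ioo_mem_nhds hx.1 hx.2] with t ht using hzzero t ht)
    simpa [hμ, (hcos x hx).ne'] using h0
  have hcl : EqOn y (fun _ => 0) (Icc (-a) a) := by
    refine EqOn.of_subset_closure (s := Ioo (-a) a) hyzero hyc continuousOn_const
      Ioo_subset_Icc_self ?_
    rw [closure_Ioo (by linarith)]
  exact hyx₀ (hcl hx₀)

/-- `φ = S² - s²` is a supersolution for `l = 2 / S²` because `S² - s² ≤ S² (1 - s²)` when `S ≤ 1`.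
-/
theorem two_div_sin_sq_le_of_isNeumannEigenvalue {a μ : ℝ} (ha : 0 < a)
    (hapi : a ≤ Real.pi / 2) (hμ : μ ≠ 0) (hev : IsNeumannEigenvalue (2 * a) μ) :
    2 / Real.sin a ^ 2 ≤ μ := by
  have hS : 0 < Real.sin a := Real.sin_pos_of_pos_of_lt_pi ha (by linarith [Real.pi_pos])
  have hS1 : Real.sin a ≤ 1 := Real.sin_le_one a
  refine le_of_isNeumannEigenvalue_of_supersolution ha hapi (φ := fun s => Real.sin a ^ 2 - s ^ 2)
    (φ₁ := fun s => -(2 * s)) (φ₂ := fun _ => -2) (c := Real.sin a) (K := 2) hS ?_ ?_ ?_ ?_ ?_ hμ hev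
  · intro s _
    simpa using ((hasDerivAt_pow 2 s).const_sub (Real.sin a ^ 2))
  · intro s _
    simpa using (HasDerivAt.fun_neg ((hasDerivAt_id s).const_mul (2 : ℝ)))
  · intro s hs
    have h := abs_lt.2 hs
    have h0 := abs_nonneg s
    rw [← sq_abs s]
    nlinarith
  · intro s hs
    have h := abs_lt.2 hs
    rw [abs_neg, abs_mul, abs_two]
    linarith
  · intro s hs
    have h : s ^ 2 < Real.sin a ^ 2 := sq_lt_sq' hs.1 hs.2
    have h1 : Real.sin a ^ 2 ≤ 1 := pow_le_one₀ hS.le hS1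
    have h2 : 0 < 1 - s ^ 2 := by linarith
    rw [neg_le_neg_iff, div_mul_eq_mul_div, div_div, div_le_iff₀ (by positivity)]
    nlinarith [sq_nonneg s]

theorem isNeumannEigenvalue_pi_two : IsNeumannEigenvalue Real.pi 2 := by
  refine ⟨Real.sin, Real.cos, ⟨Real.pi / 2, ⟨by linarith [Real.pi_pos], le_rfl⟩, by simp⟩,
    fun x _ => (Real.hasDerivAt_sin x).hasDerivWithinAt, fun x _ => ?_, by simp, by simp⟩
  refine (((Real.hasDerivAt_cos x).mul (Real.hasDerivAt_cos x)).congr_deriv ?_).hasDerivWithinAt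
  ring

/-! ### Power series with polynomially bounded coefficients. -/

/-- The sum of the power series with coefficients `c`. -/
noncomputable def powSum (c : ℕ → ℝ) (s : ℝ) : ℝ := ∑' n, c n * s ^ n

/-- The coefficients of the differentiated power series. -/
def diffCoeff (c : ℕ → ℝ) (n : ℕ) : ℝ := (n + 1) * c (n + 1)

theorem summable_succ_pow_mul_geometric (C : ℝ) (k : ℕ) {r : ℝ} (hr : 0 < r) (hr1 : r < 1) :
    Summable fun n : ℕ => C * ((n : ℝ) + 1) ^ k * r ^ n := by
  have h := summable_pow_mul_geometric_of_norm_lt_one k (r := r)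
    (by rwa [Real.norm_eq_abs, abs_of_pos hr])
  have h1 := ((summable_nat_add_iff 1).2 h).mul_left (C * r⁻¹)
  refine h1.congr fun n => ?_
  push_cast
  field_simp
  ring

theorem diffCoeff_growth {c : ℕ → ℝ} {C : ℝ} {k : ℕ}
    (hc : ∀ n, |c n| ≤ C * ((n : ℝ) + 1) ^ k) (n : ℕ) :
    |diffCoeff c n| ≤ C * 2 ^ k * ((n : ℝ) + 1) ^ (k + 1) := by
  have hC : 0 ≤ C := by simpa using (abs_nonneg _).trans (hc 0)
  have h1 : (0 : ℝ) ≤ (n : ℝ) + 1 := by positivity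
  have h2 : ((n + 1 : ℕ) : ℝ) + 1 ≤ 2 * ((n : ℝ) + 1) := by push_cast; linarith
  have h3 : |c (n + 1)| ≤ C * (2 * ((n : ℝ) + 1)) ^ k :=
    (hc (n + 1)).trans (by gcongr)
  rw [diffCoeff, abs_mul, abs_of_nonneg h1]
  refine (mul_le_mul_of_nonneg_left h3 h1).trans_eq ?_
  rw [mul_pow]; ring

theorem summable_powSum {c : ℕ → ℝ} {C : ℝ} {k : ℕ}
    (hc : ∀ n, |c n| ≤ C * ((n : ℝ) + 1) ^ k) {s : ℝ} (hs : |s| < 1) :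
    Summable fun n => c n * s ^ n := by
  obtain ⟨r, hsr, hr1⟩ := exists_between hs
  have hr : 0 < r := (abs_nonneg s).trans_lt hsr
  have hC : 0 ≤ C := by simpa using (abs_nonneg _).trans (hc 0)
  refine Summable.of_norm_bounded (summable_succ_pow_mul_geometric C k hr hr1) fun n => ?_
  rw [Real.norm_eq_abs, abs_mul, abs_pow]
  gcongr
  exact hc n

theorem hasDerivAt_powSum {c : ℕ → ℝ} {C : ℝ} {k : ℕ}
    (hc : ∀ n, |c n| ≤ C * ((n : ℝ) + 1) ^ k) {s : ℝ} (hs : |s| < 1) :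
    HasDerivAt (powSum c) (powSum (diffCoeff c) s) s := by
  obtain ⟨r, hsr, hr1⟩ := exists_between hs
  have hr : 0 < r := (abs_nonneg s).trans_lt hsr
  have hC : 0 ≤ C := by simpa using (abs_nonneg _).trans (hc 0)
  have hu := (summable_succ_pow_mul_geometric C (k + 1) hr hr1).mul_right r⁻¹
  have hbd : ∀ (n : ℕ) (y : ℝ), y ∈ Ioo (-r) r →
      ‖c n * ((n : ℝ) * y ^ (n - 1))‖ ≤ C * ((n : ℝ) + 1) ^ (k + 1) * r ^ n * r⁻¹ := by
    intro n y hy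
    have hyr : |y| ≤ r := (abs_lt.2 hy).le
    rw [Real.norm_eq_abs, abs_mul, abs_mul, abs_pow, Nat.abs_cast]
    cases n with
    | zero => simp; positivity
    | succ m =>
      have hm := hc (m + 1)
      calc |c (m + 1)| * (((m + 1 : ℕ) : ℝ) * |y| ^ (m + 1 - 1))
          ≤ C * (((m + 1 : ℕ) : ℝ) + 1) ^ k * ((((m + 1 : ℕ) : ℝ) + 1) * r ^ m) := by
            rw [Nat.add_sub_cancel]
            gcongr
            linarith
        _ = _ := by field_simp; ring
  have hder := hasDerivAt_tsum_of_isPreconnected (g := fun n z => c n * z ^ n)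
    (g' := fun n y => c n * ((n : ℝ) * y ^ (n - 1))) hu isOpen_Ioo isPreconnected_Ioo
    (fun n y _ => (hasDerivAt_pow n y).const_mul (c n)) hbd (abs_lt.1 hsr)
    (summable_powSum hc hs) (abs_lt.1 hsr)
  refine hder.congr_deriv ?_
  have hsum : Summable fun n => c n * ((n : ℝ) * s ^ (n - 1)) :=
    Summable.of_norm_bounded hu fun n => hbd n s (abs_lt.1 hsr)
  rw [hsum.tsum_eq_zero_add, powSum]
  simp only [Nat.cast_zero, zero_mul, mul_zero, zero_add]
  refine tsum_congr fun n => ?_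
  simp only [diffCoeff, Nat.add_sub_cancel]
  push_cast
  ring

/-! ### The even solution of the transformed equation. -/

/-- Taylor coefficients of the even solution of `(1 - s²) Z'' + μ Z = 0`, `Z 0 = 1`. -/
noncomputable def neumannCoeff (μ : ℝ) : ℕ → ℝ
  | 0 => 1
  | 1 => 0
  | n + 2 => ((n : ℝ) * (n - 1) - μ) / ((n + 2) * (n + 1)) * neumannCoeff μ n

/-- The exponent depends only on a bound for `|μ|`, which gives convergence uniform in `μ`.
Bernoulli's inequality compares the recursion factor with `((n + 3)/(n + 1)) ^ k`; the constant 4 is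
what `n = 0` allows. -/
theorem neumannCoeff_growth {μ : ℝ} {k : ℕ} (hk : |μ| ≤ 4 * k) :
    ∀ n : ℕ, |neumannCoeff μ n| ≤ ((n : ℝ) + 1) ^ k
  | 0 => by simp [neumannCoeff]
  | 1 => by simp only [neumannCoeff, abs_zero]; positivity
  | n + 2 => by
    have ih := neumannCoeff_growth hk n
    have hn : (0 : ℝ) ≤ n := n.cast_nonneg
    have hnn : (0 : ℝ) ≤ (n : ℝ) * (n - 1) := by
      rcases n with _ | n
      · simp
      · push_cast; ring_nf; positivity
    rw [neumannCoeff, abs_mul, abs_div, abs_of_pos (by positivity : (0:ℝ) < (n + 2) * (n + 1)),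
      div_mul_eq_mul_div, div_le_iff₀ (by positivity)]
    have h1 : |(n : ℝ) * (n - 1) - μ| ≤ n * (n - 1) + 4 * k := by
      refine (abs_sub _ _).trans ?_
      rw [abs_of_nonneg hnn]; linarith
    have h2 : 1 + (k : ℝ) * (2 / (n + 1)) ≤ (1 + 2 / ((n : ℝ) + 1)) ^ k :=
      one_add_mul_le_pow (by linarith [show (0 : ℝ) ≤ 2 / ((n : ℝ) + 1) by positivity]) k
    have h3 : (((n + 2 : ℕ) : ℝ) + 1) ^ k =
        (1 + 2 / ((n : ℝ) + 1)) ^ k * ((n : ℝ) + 1) ^ k := by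
      rw [← mul_pow]; congr 1; push_cast; field_simp; ring
    have h4 : (n : ℝ) * (n - 1) + 4 * k ≤
        (1 + (k : ℝ) * (2 / (n + 1))) * ((n + 2) * (n + 1)) := by
      have : (1 + (k : ℝ) * (2 / (n + 1))) * ((n + 2) * (n + 1)) =
          (n + 2) * (n + 1) + 2 * k * (n + 2) := by field_simp
      rw [this]
      have : (0 : ℝ) ≤ k * n := by positivity
      nlinarith
    rw [h3]
    calc _ ≤ ((n : ℝ) * (n - 1) + 4 * k) * ((n : ℝ) + 1) ^ k := by gcongr
      _ ≤ (1 + (k : ℝ) * (2 / (n + 1))) * ((n + 2) * (n + 1)) * ((n : ℝ) + 1) ^ k := by gcongr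
      _ ≤ (1 + 2 / ((n : ℝ) + 1)) ^ k * ((n + 2) * (n + 1)) * ((n : ℝ) + 1) ^ k := by gcongr
      _ = _ := by ring

theorem exists_neumannCoeff_growth (M : ℝ) : ∃ k : ℕ, ∀ μ : ℝ, |μ| ≤ M →
    ∀ n : ℕ, |neumannCoeff μ n| ≤ 1 * ((n : ℝ) + 1) ^ k := by
  obtain ⟨k, hk⟩ := exists_nat_ge (M / 4)
  refine ⟨k, fun μ hμ n => ?_⟩
  rw [one_mul]
  exact neumannCoeff_growth (by linarith) n

/-- The even solution of `(1 - s²) Z'' + μ Z = 0`, `Z 0 = 1`, on `(-1, 1)`. -/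
noncomputable def neumannSol (μ : ℝ) : ℝ → ℝ := powSum (neumannCoeff μ)

/-- The derivative of `neumannSol μ`. -/
noncomputable def neumannSolDeriv (μ : ℝ) : ℝ → ℝ := powSum (diffCoeff (neumannCoeff μ))

theorem hasDerivAt_neumannSol (μ : ℝ) {s : ℝ} (hs : |s| < 1) :
    HasDerivAt (neumannSol μ) (neumannSolDeriv μ s) s := by
  obtain ⟨k, hk⟩ := exists_neumannCoeff_growth |μ|
  exact hasDerivAt_powSum (hk μ le_rfl) hs

theorem hasDerivAt_neumannSolDeriv (μ : ℝ) {s : ℝ} (hs : |s| < 1) :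
    HasDerivAt (neumannSolDeriv μ) (-(μ * neumannSol μ s / (1 - s ^ 2))) s := by
  obtain ⟨k, hk⟩ := exists_neumannCoeff_growth |μ|
  have hc := hk μ le_rfl
  have hc₂ := diffCoeff_growth (diffCoeff_growth hc)
  refine (hasDerivAt_powSum (diffCoeff_growth hc) hs).congr_deriv ?_
  -- `A` sums to `Z''` and `B` to `s² Z''`; the recursion makes `A - B` termwise `-μ` times the
  -- series of `Z`.
  set A : ℕ → ℝ := fun n => diffCoeff (diffCoeff (neumannCoeff μ)) n * s ^ n with hA
  set B : ℕ → ℝ := fun n => (n : ℝ) * (n - 1) * neumannCoeff μ n * s ^ n with hB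
  have hAs : Summable A := summable_powSum hc₂ hs
  have hBA : ∀ n, B (n + 2) = s ^ 2 * A n := fun n => by
    simp only [hA, hB, diffCoeff]; push_cast; ring
  have hBs : Summable B := by
    refine (summable_nat_add_iff 2).1 ?_
    simp only [hBA]
    exact hAs.mul_left _
  have hBt : ∑' n, B n = s ^ 2 * ∑' n, A n := by
    rw [← hBs.sum_add_tsum_nat_add 2, ← tsum_mul_left]
    simp only [hBA]
    simp [Finset.sum_range_succ, hB]
  have hAB : ∑' n, A n - ∑' n, B n = -μ * neumannSol μ s := by
    rw [← hAs.tsum_sub hBs, neumannSol, powSum, ← tsum_mul_left]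
    refine tsum_congr fun n => ?_
    simp only [hA, hB, diffCoeff, neumannCoeff]
    push_cast
    field_simp
    ring
  have hs2 : 0 < 1 - s ^ 2 := by
    have := (sq_lt_one_iff_abs_lt_one s).2 hs
    linarith
  change ∑' n, A n = _
  rw [← neg_div, eq_div_iff hs2.ne']
  linarith

theorem neumannSol_zero_right (μ : ℝ) : neumannSol μ 0 = 1 := by
  rw [neumannSol, powSum, tsum_eq_single 0 (fun n hn => by simp [hn])]
  simp [neumannCoeff]

theorem neumannSolDeriv_zero_right (μ : ℝ) : neumannSolDeriv μ 0 = 0 := by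
  rw [neumannSolDeriv, powSum, tsum_eq_single 0 (fun n hn => by simp [hn])]
  simp [neumannCoeff, diffCoeff]

theorem neumannCoeff_odd (μ : ℝ) : ∀ n : ℕ, neumannCoeff μ n * (-1) ^ n = neumannCoeff μ n
  | 0 => by simp
  | 1 => by simp [neumannCoeff]
  | n + 2 => by rw [neumannCoeff, pow_add, neg_one_sq, mul_one, mul_assoc, neumannCoeff_odd μ n]

theorem neumannSol_neg (μ s : ℝ) : neumannSol μ (-s) = neumannSol μ s := by
  refine tsum_congr fun n => ?_
  rw [neg_pow, ← mul_assoc, neumannCoeff_odd]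

theorem neumannCoeff_zero_left : ∀ n : ℕ, n ≠ 0 → neumannCoeff 0 n = 0
  | 0 => by simp
  | 1 => by simp [neumannCoeff]
  | 2 => by simp [neumannCoeff]
  | n + 3 => fun _ => by rw [neumannCoeff, neumannCoeff_zero_left (n + 1) (by simp), mul_zero]

theorem neumannSol_zero_left (s : ℝ) : neumannSol 0 s = 1 := by
  rw [neumannSol, powSum, tsum_eq_single 0 (fun n hn => by simp [neumannCoeff_zero_left n hn])]
  simp [neumannCoeff]

theorem continuous_neumannCoeff : ∀ n : ℕ, Continuous fun μ => neumannCoeff μ n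
  | 0 => by simpa only [neumannCoeff] using continuous_const
  | 1 => by simpa only [neumannCoeff] using continuous_const
  | n + 2 => by
    have := continuous_neumannCoeff n
    simp only [neumannCoeff]
    fun_prop

theorem continuousOn_neumannSol (M : ℝ) {S : ℝ} (hS : 0 < S) (hS1 : S < 1) :
    ContinuousOn (fun p : ℝ × ℝ => neumannSol p.1 p.2) (Icc 0 M ×ˢ Icc 0 S) := by
  obtain ⟨k, hk⟩ := exists_neumannCoeff_growth M
  refine continuousOn_tsum (fun n => Continuous.continuousOn ?_)
    (summable_succ_pow_mul_geometric 1 k hS hS1) fun n p hp => ?_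
  · exact ((continuous_neumannCoeff n).comp continuous_fst).mul (continuous_snd.pow n)
  · have hp1 : |p.1| ≤ M := by rw [abs_of_nonneg hp.1.1]; exact hp.1.2
    have hp2 : |p.2| ≤ S := by rw [abs_of_nonneg hp.2.1]; exact hp.2.2
    rw [Real.norm_eq_abs, abs_mul, abs_pow]
    gcongr
    exact hk _ hp1 n

/-! ### The first parameter with a zero in `[0, S]`. -/

theorem exists_neumannSol_nonpos {S : ℝ} (hS : 0 < S) (hS1 : S < 1) :
    ∃ s ∈ Icc 0 S, neumannSol ((Real.pi / (2 * S)) ^ 2) s ≤ 0 := by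
  set k : ℝ := Real.pi / (2 * S) with hk
  have hk0 : 0 < k := by positivity
  have hkS : k * S = Real.pi / 2 := by rw [hk]; field_simp
  by_contra! hpos
  have habs : ∀ s ∈ Icc 0 S, |s| < 1 := fun s hs => by
    rw [abs_of_nonneg hs.1]; linarith [hs.2]
  -- Sturm comparison with `cos (k s)`, which vanishes at `S`. If `Z > 0`, this Wronskian increases
  -- from 0, yet it equals `-k Z(S) < 0` at `S`.
  set W : ℝ → ℝ := fun s => neumannSol (k ^ 2) s * (-(k * Real.sin (k * s))) -
    neumannSolDeriv (k ^ 2) s * Real.cos (k * s) with hW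
  set W' : ℝ → ℝ := fun s => Real.cos (k * s) * neumannSol (k ^ 2) s * k ^ 2 *
    (1 / (1 - s ^ 2) - 1) with hW'
  have hd : ∀ s ∈ Icc 0 S, HasDerivAt W (W' s) s := by
    intro s hs
    have hl : HasDerivAt (fun s => k * s) k s := by
      simpa using (hasDerivAt_id s).const_mul k
    have h1 := (hasDerivAt_neumannSol (k ^ 2) (habs s hs)).mul
      ((hl.sin.const_mul k).fun_neg)
    have h2 := (hasDerivAt_neumannSolDeriv (k ^ 2) (habs s hs)).mul hl.cos
    refine (h1.sub h2).congr_deriv ?_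
    simp only [hW']
    ring
  have hmono : MonotoneOn W (Icc 0 S) := by
    refine monotoneOn_of_hasDerivWithinAt_nonneg (convex_Icc _ _) (f' := W')
      (fun s hs => (hd s hs).continuousAt.continuousWithinAt)
      (fun s hs => (hd s (interior_subset hs)).hasDerivWithinAt) fun s hs => ?_
    have hs := interior_subset hs
    have hcos : 0 ≤ Real.cos (k * s) := by
      have h1 : k * s ≤ k * S := mul_le_mul_of_nonneg_left hs.2 hk0.le
      have h2 : 0 ≤ k * s := mul_nonneg hk0.le hs.1
      exact Real.cos_nonneg_of_mem_Icc ⟨by linarith [Real.pi_pos], by linarith⟩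
    have hs2 : 0 < 1 - s ^ 2 := by
      have := (sq_lt_one_iff_abs_lt_one s).2 (habs s hs)
      linarith
    have hq : 0 ≤ 1 / (1 - s ^ 2) - 1 := by
      rw [sub_nonneg, le_div_iff₀ hs2]; nlinarith
    have := (hpos s hs).le
    simp only [hW']
    positivity
  have h := hmono (left_mem_Icc.2 hS.le) (right_mem_Icc.2 hS.le) hS.le
  simp only [hW, mul_zero, Real.sin_zero, Real.cos_zero, neg_zero, neumannSolDeriv_zero_right,
    sub_zero, hkS, Real.sin_pi_div_two, Real.cos_pi_div_two, mul_one] at h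
  nlinarith [mul_pos (hpos S (right_mem_Icc.2 hS.le)) hk0]

theorem exists_neumannSol_eq_zero {S : ℝ} (hS : 0 < S) (hS1 : S < 1) :
    ∃ μ : ℝ, 0 < μ ∧ neumannSol μ S = 0 ∧ ∀ s ∈ Icc (-S) S, 1 - |s| / S ≤ neumannSol μ s := by
  set M : ℝ := (Real.pi / (2 * S)) ^ 2 with hM
  have hM0 : 0 ≤ M := sq_nonneg _
  have hcont := continuousOn_neumannSol M hS hS1
  set A : Set (ℝ × ℝ) := {p | p ∈ Icc 0 M ×ˢ Icc 0 S ∧ neumannSol p.1 p.2 = 0} with hA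
  have hAc : IsCompact A := (isCompact_Icc.prod isCompact_Icc).of_isClosed_subset
    (hcont.preimage_isClosed_of_isClosed (isClosed_Icc.prod isClosed_Icc)
      (isClosed_singleton (x := (0 : ℝ)))) fun p hp => hp.1
  have hAne : A.Nonempty := by
    obtain ⟨s, hs, hle⟩ := exists_neumannSol_nonpos hS hS1
    have hc : ContinuousOn (neumannSol M) (Icc 0 s) :=
      hcont.comp (f := fun t : ℝ => (M, t)) (by fun_prop) fun t ht =>
        ⟨right_mem_Icc.2 hM0, ht.1, ht.2.trans hs.2⟩
    obtain ⟨t, ht, h0⟩ := intermediate_value_Icc' hs.1 hc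
      (show (0 : ℝ) ∈ Icc _ _ from ⟨hle, by rw [neumannSol_zero_right]; exact zero_le_one⟩)
    exact ⟨(M, t), ⟨right_mem_Icc.2 hM0, ht.1, ht.2.trans hs.2⟩, h0⟩
  -- The zero set is compact, so a smallest `μ` exists.
  obtain ⟨⟨μ, s₀⟩, ⟨⟨hμ, hs₀⟩, hzero⟩, hmin⟩ :=
    hAc.exists_isMinOn hAne (continuous_fst.continuousOn)
  simp only at hμ hs₀ hzero
  have hμ0 : 0 < μ := by
    refine lt_of_le_of_ne hμ.1 fun h => ?_
    rw [← h, neumannSol_zero_left] at hzero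
    exact one_ne_zero hzero
  -- A negative value at `s` would give a zero at a smaller parameter, since the solution is 1 at
  -- parameter 0. Nonnegativity then forces concavity through the equation.
  have hnn : ∀ s ∈ Icc 0 S, 0 ≤ neumannSol μ s := by
    intro s hs
    by_contra! hneg
    have hc : ContinuousOn (fun ν => neumannSol ν s) (Icc 0 μ) :=
      hcont.comp (f := fun t : ℝ => (t, s)) (by fun_prop) fun t ht =>
        ⟨⟨ht.1, ht.2.trans hμ.2⟩, hs⟩
    obtain ⟨ν, hν, h0⟩ := intermediate_value_Icc' hμ.1 hc
      (show (0 : ℝ) ∈ Icc _ _ from ⟨hneg.le, by rw [neumannSol_zero_left]; exact zero_le_one⟩)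
    have hle : μ ≤ ν := hmin (show (ν, s) ∈ A from ⟨⟨⟨hν.1, hν.2.trans hμ.2⟩, hs⟩, h0⟩)
    obtain rfl := le_antisymm hle hν.2
    exact hneg.ne h0
  have habs : ∀ s ∈ Icc 0 S, |s| < 1 := fun s hs => by
    rw [abs_of_nonneg hs.1]; linarith [hs.2]
  have hconc : ConcaveOn ℝ (Icc 0 S) (neumannSol μ) := by
    refine concaveOn_of_hasDerivWithinAt2_nonpos (convex_Icc _ _)
      (fun s hs => (hasDerivAt_neumannSol μ (habs s hs)).continuousAt.continuousWithinAt)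
      (fun s hs => (hasDerivAt_neumannSol μ (habs s (interior_subset hs))).hasDerivWithinAt)
      (fun s hs => (hasDerivAt_neumannSolDeriv μ (habs s (interior_subset hs))).hasDerivWithinAt)
      fun s hs => ?_
    have hs := interior_subset hs
    have hs2 : 0 < 1 - s ^ 2 := by
      have := (sq_lt_one_iff_abs_lt_one s).2 (habs s hs)
      linarith
    have := hnn s hs
    rw [neg_nonpos]
    positivity
  have hlow : ∀ s ∈ Icc 0 S, 1 - s / S ≤ neumannSol μ s := by
    intro s hs
    have hsS : s / S ≤ 1 := (div_le_one hS).2 hs.2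
    have h0 : 0 ≤ s / S := div_nonneg hs.1 hS.le
    have h := hconc.2 (left_mem_Icc.2 hS.le) (right_mem_Icc.2 hS.le)
      (sub_nonneg.2 hsS) h0 (by ring)
    simp only [smul_eq_mul, mul_zero, zero_add, neumannSol_zero_right, mul_one,
      div_mul_cancel₀ _ hS.ne'] at h
    linarith [mul_nonneg h0 (hnn S (right_mem_Icc.2 hS.le))]
  refine ⟨μ, hμ0, ?_, fun s hs => ?_⟩
  -- The chord bound is positive before `S`, so the zero `s₀` is `S` itself.
  · have h := hlow s₀ hs₀
    rw [hzero, sub_nonpos, one_le_div hS] at h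
    rwa [le_antisymm hs₀.2 h] at hzero
  · have h := hlow |s| ⟨abs_nonneg s, abs_le.2 hs⟩
    rcases abs_choice s with h' | h' <;> rw [h'] at h ⊢
    · exact h
    · rwa [neumannSol_neg] at h

/-! ### Back to the Neumann problem. -/

theorem isNeumannEigenvalue_of_neumannSol_eq_zero {a μ : ℝ} (ha : 0 < a)
    (hapi : a < Real.pi / 2) (hμ : μ ≠ 0) (hz : neumannSol μ (Real.sin a) = 0) :
    IsNeumannEigenvalue (2 * a) μ := by
  have hcos : ∀ x ∈ Icc (-a) a, 0 < Real.cos x := fun x hx =>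
    Real.cos_pos_of_mem_Ioo ⟨by linarith [hx.1], by linarith [hx.2]⟩
  have hsin : ∀ x ∈ Icc (-a) a, |Real.sin x| < 1 := fun x hx => by
    rw [← sq_lt_one_iff_abs_lt_one, Real.sin_sq]
    linarith [pow_pos (hcos x hx) 2]
  -- Inverts `dZ/ds = -μ y`.
  set y : ℝ → ℝ := fun x => -(neumannSolDeriv μ (Real.sin x)) / μ with hydef
  have hy : ∀ x ∈ Icc (-a) a,
      HasDerivAt y (neumannSol μ (Real.sin x) / Real.cos x) x := by
    intro x hx
    have h := (((hasDerivAt_neumannSolDeriv μ (hsin x hx)).comp x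
      (Real.hasDerivAt_sin x)).fun_neg).div_const μ
    refine h.congr_deriv ?_
    have := (hcos x hx).ne'
    rw [← Real.cos_sq']
    field_simp
  unfold IsNeumannEigenvalue
  rw [show 2 * a / 2 = a by ring]
  refine ⟨y, fun x => neumannSol μ (Real.sin x) / Real.cos x, ?_,
    fun x hx => (hy x hx).hasDerivWithinAt, fun x hx => ?_, ?_, ?_⟩
  · by_contra! hzero
    have h0 : (0 : ℝ) ∈ Icc (-a) a := ⟨by linarith, ha.le⟩
    have h := (hy 0 h0).unique <| (hasDerivAt_const (0 : ℝ) (0 : ℝ)).congr_of_eventuallyEq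
      (by filter_upwards [Icc_mem_nhds (neg_lt_zero.2 ha) ha] with t ht using hzero t ht)
    simp [neumannSol_zero_right] at h
  · have h := ((hasDerivAt_neumannSol μ (hsin x hx)).comp x
      (Real.hasDerivAt_sin x)).hasDerivWithinAt (s := Icc (-a) a)
    refine (h.congr_of_mem (fun t ht => ?_) hx).congr_deriv ?_
    · simp [div_mul_cancel₀ _ (hcos t ht).ne']
    · simp only [hydef]; field_simp
  · simp [neumannSol_neg, hz]
  · simp [hz]

theorem isLeast_nonzeroNeumannEigenvalues {a μ : ℝ} (ha : 0 < a) (hapi : a < Real.pi / 2)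
    (hμ : 0 < μ) (hz : neumannSol μ (Real.sin a) = 0)
    (hlow : ∀ s ∈ Icc (-Real.sin a) (Real.sin a), 1 - |s| / Real.sin a ≤ neumannSol μ s) :
    IsLeast (nonzeroNeumannEigenvalues (2 * a)) μ := by
  refine ⟨⟨hμ.ne', isNeumannEigenvalue_of_neumannSol_eq_zero ha hapi hμ.ne' hz⟩, ?_⟩
  rintro ν ⟨hν, hev⟩
  have hS : 0 < Real.sin a := Real.sin_pos_of_pos_of_lt_pi ha (by linarith)
  have hS1 : Real.sin a < 1 := by
    rw [← Real.sin_pi_div_two]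
    exact Real.sin_lt_sin_of_lt_of_le_pi_div_two (by linarith) le_rfl hapi
  have habs : ∀ s ∈ Icc (-Real.sin a) (Real.sin a), |s| < 1 := fun s hs =>
    (abs_le.2 hs).trans_lt hS1
  have hcont : ContinuousOn (neumannSolDeriv μ) (Icc (-Real.sin a) (Real.sin a)) := fun s hs =>
    (hasDerivAt_neumannSolDeriv μ (habs s hs)).continuousAt.continuousWithinAt
  obtain ⟨K, hK⟩ := isCompact_Icc.exists_bound_of_continuousOn hcont
  refine le_of_isNeumannEigenvalue_of_supersolution ha hapi.le (c := (Real.sin a)⁻¹) (K := K)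
    (inv_pos.2 hS) (fun s hs => hasDerivAt_neumannSol μ (habs s (Ioo_subset_Icc_self hs)))
    (fun s hs => hasDerivAt_neumannSolDeriv μ (habs s (Ioo_subset_Icc_self hs)))
    (fun s hs => ?_) (fun s hs => hK s (Ioo_subset_Icc_self hs)) (fun s _ => le_rfl) hν hev
  refine le_trans (le_of_eq ?_) (hlow s (Ioo_subset_Icc_self hs))
  field_simp

theorem exists_isLeast_nonzeroNeumannEigenvalues {a : ℝ} (ha : 0 < a) (hapi : a ≤ Real.pi / 2) :
    ∃ μ, IsLeast (nonzeroNeumannEigenvalues (2 * a)) μ := by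
  rcases hapi.lt_or_eq with hlt | rfl
  · have hS : 0 < Real.sin a := Real.sin_pos_of_pos_of_lt_pi ha (by linarith)
    have hS1 : Real.sin a < 1 := by
      rw [← Real.sin_pi_div_two]
      exact Real.sin_lt_sin_of_lt_of_le_pi_div_two (by linarith) le_rfl hlt
    obtain ⟨μ, hμ, hz, hlow⟩ := exists_neumannSol_eq_zero hS hS1
    exact ⟨μ, isLeast_nonzeroNeumannEigenvalues ha hlt hμ hz hlow⟩
  · refine ⟨2, ⟨two_ne_zero, ?_⟩, fun ν hν => ?_⟩
    · rw [mul_div_cancel₀ _ two_ne_zero]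
      exact isNeumannEigenvalue_pi_two
    · simpa using two_div_sin_sq_le_of_isNeumannEigenvalue ha le_rfl hν.1 hν.2

theorem mainTheorem6 (d : ℝ) (hd : 0 < d) (hdpi : d ≤ Real.pi) :
    IsLeast (nonzeroNeumannEigenvalues d) (firstNeumannEigenvalue d) ∧
      2 + 2 * (1 - Real.sin (d / 2)) ≤ firstNeumannEigenvalue d := by
  obtain ⟨a, rfl⟩ : ∃ a, d = 2 * a := ⟨d / 2, by ring⟩
  have ha : 0 < a := by linarith
  have hapi : a ≤ Real.pi / 2 := by linarith
  obtain ⟨μ, hμ⟩ := exists_isLeast_nonzeroNeumannEigenvalues ha hapi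
  have hinf : firstNeumannEigenvalue (2 * a) = μ := hμ.csInf_eq
  rw [hinf]
  refine ⟨hμ, le_trans ?_ (two_div_sin_sq_le_of_isNeumannEigenvalue ha hapi hμ.1.1 hμ.1.2)⟩
  rw [show 2 * a / 2 = a by ring]
  have hS : 0 < Real.sin a := Real.sin_pos_of_pos_of_lt_pi ha (by linarith [Real.pi_pos])
  have hS1 : Real.sin a ≤ 1 := Real.sin_le_one a
  -- `2 - S² (4 - 2S) = 2 (1 - S)(1 + S - S²)`.
  rw [le_div_iff₀ (by positivity)]
  nlinarith [mul_nonneg (sub_nonneg.2 hS1)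
    (show 0 ≤ 1 + Real.sin a - Real.sin a ^ 2 by nlinarith)]
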